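/- **Definitions.** An *effect algebra* is $(\mathcal E,0,1,\oplus)$ with $0\neq 1$ and a partial binary operation $\oplus$ (write $a\perp b$ if $a\oplus b$ is defined) such that: (E1) $a\perp b$ implies $b\perp a$ and $b\oplus a=a\oplus b$; (E2) if $a\perp b$ and $(a\oplus b)\perp c$, then $b\perp c$, $a\perp(b\oplus c)$ and $a\oplus(b\oplus c)=(a\oplus b)\oplus c$; (E3) for every $a$ there is a unique $a'$ with $a\perp a'$ and $a\oplus a'=1$; (E4) $a\perp 1$ implies $a=0$. Put $a\le b$ if $a\oplus c=b$ for some $c$. It is *convex* if it has a scalar multiplication $[0,1]\times\mathcal E\to\mathcal E$ with $\alpha(\beta a)=(\alpha\beta)a$; $\alpha a\perp\beta a$ and $(\alpha+\beta)a=\alpha a\oplus\beta a$ if $\alpha+\beta\le1$; $\lambda a\perp\lambda b$ and $\lambda(a\oplus b)=\lambda a\oplus\lambda b$ if $a\perp b$; and $1a=a$. A map $\phi$ of effect algebras is *additive* if $a\perp b$ implies $\phi(a)\perp\phi(b)$ and $\phi(a\oplus b)=\phi(a)\oplus\phi(b)$; it is a *morphism* if moreover $\phi(1)=1$, and an *isomorphism*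 if moreover it is surjective and $\phi(a)\perp\phi(b)$ implies $a\perp b$; it is *affine* if $\phi(\lambda a)=\lambda\phi(a)$. A *state* is a morphism into $[0,1]\subseteq\mathbb R$. A *convex sequential effect algebra* (convex SEA) is a convex effect algebra with a binary operation $\circ$ such that, writing $a|b$ for $a\circ b=b\circ a$: (S1) $b\mapsto a\circ b$ is additive; (S2) $1\circ a=a$; (S3) $a\circ b=0$ implies $a|b$; (S4) $a|b$ implies $a|b'$ and $a\circ(b\circ c)=(a\circ b)\circ c$ for all $c$; (S5) if $c|a$ and $c|b$, then $c|(a\circ b)$, and $c|(a\oplus b)$ whenever $a\perp b$; (S6) $(\lambda a)\circ b=a\circ(\lambda b)=\lambda(a\circ b)$ for $\lambda\in[0,1]$. A *SEA isomorphism* is an affine isomorphism that preserves the sequential products. An effect $a$ is *sharp* if the greatest lower bound of $a$ and $a'$ is $0$; a sharp $a\ne0$ is *one-dimensional* if every $b\le a$ is $\lambda a$ for some $\lambda\in[0,1]$. A *context* is a finite set $\mathcal A=\{a_1,\dots,a_n\}$ of one-dimensional sharp effects with $a_1\oplus\cdots\oplus a_n=1$. $\mathcal E$ is *finite-dimensional*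 if it has a context, and *spectral* if every $b\in\mathcal E$ is $\lambda_1a_1\oplus\cdots\oplus\lambda_na_n$ for some context $\{a_1,\dots,a_n\}$ and $\lambda_i\in[0,1]$. For each one-dimensional sharp $a$ fix a state $\widehat a$ with $\widehat a(a)=1$. For a context $\mathcal A$ let $\mathcal H(\mathcal A)=\{\sum_i\alpha_i\widehat a_i:\alpha_i\in\mathbb C\}$ be the complex Hilbert space with orthonormal basis $\widehat a_1,\dots,\widehat a_n$. The set of contexts is *complete* if there are unitary maps $U_{\mathcal A\mathcal B}\colon\mathcal H(\mathcal A)\to\mathcal H(\mathcal B)$, for all contexts $\mathcal A,\mathcal B$, such that $U_{\mathcal A\mathcal A}=I$, $U_{\mathcal A\mathcal B}=U_{\mathcal B\mathcal A}^*$, $|\langle U_{\mathcal A\mathcal B}\widehat a,U_{\mathcal C\mathcal B}\widehat c\rangle|^2=\widehat a(c)$ for all contexts $\mathcal A,\mathcal B,\mathcal C$ and $a\in\mathcal A$, $c\in\mathcal C$, and such that for every context $\mathcal B$ and every unit vector $\phi\in\mathcal H(\mathcal B)$ there are a context $\mathcal A$, an $a\in\mathcal A$ and a $z\in\mathbb C$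 with $|z|=1$ and $U_{\mathcal A\mathcal B}\widehat a=z\phi$. For a nonzero complex Hilbert space $H$, $\mathcal E(H)$ is the convex effect algebra of operators $A$ on $H$ with $0\le A\le I$, where $A\perp B$ means $A+B\le I$, and then $A\oplus B=A+B$. **Theorem 4.6.** Let $(\mathcal E,\circ)$ be a finite-dimensional spectral convex SEA whose set of contexts is complete with respect to states $\widehat a$ and unitary maps $U_{\mathcal A\mathcal B}$, and let $\mathcal B$ be a context. Then there is exactly one map $J\colon\mathcal E\to\mathcal E(\mathcal H(\mathcal B))$ such that $$J(b)=\sum_i\lambda_iP(U_{\mathcal A\mathcal B}\widehat a_i)\quad\text{whenever } b=\lambda_1a_1\oplus\cdots\oplus\lambda_na_n,\ \lambda_i\in[0,1],\ \mathcal A=\{a_1,\dots,a_n\}\text{ a context},$$ where $P(\phi)$ is the orthogonal projection onto $\mathbb C\phi$; this $J$ is an affine isomorphism. There is exactly one binary operation $\cdot$ on $\mathcal E(\mathcal H(\mathcal B))$ with $J(a)\cdot J(b)=J(a\circ b)$ for all $a,b\in\mathcal E$. With this product $\mathcal E(\mathcal H(\mathcal B))$ is a convex SEA, and $J$ is a SEA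 isomorphism from $(\mathcal E,\circ)$ to $(\mathcal E(\mathcal H(\mathcal B)),\cdot)$. -/

import Mathlib

noncomputable section

universe u v

/-- An effect algebra `(E, 0, 1, ⊕)`: `perp a b` says that `a ⊕ b` is defined, and `oplus a b h`
is its value. -/
class EffectAlgebra (E : Type u) where
  zero : E
  one : E
  zero_ne_one : zero ≠ one
  perp : E → E → Prop
  oplus : (a b : E) → perp a b → E
  oplus_comm : ∀ (a b : E) (h : perp a b), ∃ h' : perp b a, oplus b a h' = oplus a b h
  oplus_assoc : ∀ (a b c : E) (hab : perp a b) (h : perp (oplus a b hab) c),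
    ∃ (hbc : perp b c) (h' : perp a (oplus b c hbc)),
      oplus a (oplus b c hbc) h' = oplus (oplus a b hab) c h
  /-- The orthosupplement `a'`, the unique effect with `a ⊕ a' = 1`. -/
  compl : E → E
  oplus_compl : ∀ a : E, ∃ h : perp a (compl a), oplus a (compl a) h = one
  compl_unique : ∀ (a b : E) (h : perp a b), oplus a b h = one → b = compl a
  eq_zero_of_perp_one : ∀ a : E, perp a one → a = zero

/-- A convex effect algebra: an effect algebra with a multiplication by scalars in `[0,1]`. -/
class ConvexEffectAlgebra (E : Type u) extends EffectAlgebra E where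
  scale : unitInterval → E → E
  scale_scale : ∀ (α β : unitInterval) (a : E), scale α (scale β a) = scale (α * β) a
  scale_add : ∀ (α β γ : unitInterval) (a : E), (γ : ℝ) = (α : ℝ) + (β : ℝ) →
    ∃ h : perp (scale α a) (scale β a), scale γ a = oplus (scale α a) (scale β a) h
  scale_oplus : ∀ (r : unitInterval) (a b : E) (h : perp a b),
    ∃ h' : perp (scale r a) (scale r b),
      scale r (oplus a b h) = oplus (scale r a) (scale r b) h'
  scale_one : ∀ a : E, scale 1 a = a

namespace EffectAlgebra

section Basic

variable {E : Type u} [EffectAlgebra E]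

/-- The order `a ≤ b` of an effect algebra. -/
def Below (a b : E) : Prop := ∃ (c : E) (h : perp a c), oplus a c h = b

/-- `a` is sharp: the greatest lower bound of `a` and `a'` exists and is `0`. -/
def IsSharp (a : E) : Prop :=
  (Below zero a ∧ Below zero (compl a)) ∧
    ∀ x : E, Below x a → Below x (compl a) → Below x zero

/-- `IsOrthoSum f s x`: the orthogonal sum of the `f i`, `i ∈ s`, is defined and equals `x`. -/
inductive IsOrthoSum {ι : Type v} (f : ι → E) : Finset ι → E → Prop
  | empty : IsOrthoSum f ∅ zero
  | cons (i : ι) (s : Finset ι) (hi : i ∉ s) (x : E) (hx : IsOrthoSum f s x)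
      (h : perp (f i) x) : IsOrthoSum f (Finset.cons i s hi) (oplus (f i) x h)

end Basic

section Maps

variable {E : Type u} {F : Type v} [EffectAlgebra E] [EffectAlgebra F]

def IsAdditive (φ : E → F) : Prop :=
  ∀ (a b : E) (h : perp a b),
    ∃ h' : perp (φ a) (φ b), φ (oplus a b h) = oplus (φ a) (φ b) h'

def IsMorphism (φ : E → F) : Prop := IsAdditive φ ∧ φ one = one

def IsMonomorphism (φ : E → F) : Prop :=
  IsMorphism φ ∧ ∀ a b : E, perp (φ a) (φ b) → perp a b

def IsIsomorphism (φ : E → F) : Prop := IsMonomorphism φ ∧ Function.Surjective φ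

end Maps

end EffectAlgebra

open EffectAlgebra ConvexEffectAlgebra

/-- An isomorphism of convex effect algebras. -/
def IsAffineIsomorphism {E : Type u} {F : Type v} [ConvexEffectAlgebra E]
    [ConvexEffectAlgebra F] (φ : E → F) : Prop :=
  IsIsomorphism φ ∧ ∀ (r : unitInterval) (a : E), φ (scale r a) = scale r (φ a)

/-- `seq` is a sequential product on the convex effect algebra `E`, that is, `E` together with
`seq` is a convex sequential effect algebra. The relation `a | b` is `seq a b = seq b a`. -/
structure IsSequentialProduct {E : Type u} [ConvexEffectAlgebra E] (seq : E → E → E) : Prop where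
  additive : ∀ a : E, IsAdditive (seq a)
  one_seq : ∀ a : E, seq one a = a
  comm_of_eq_zero : ∀ a b : E, seq a b = zero → seq a b = seq b a
  comm_compl : ∀ a b : E, seq a b = seq b a → seq a (compl b) = seq (compl b) a
  assoc : ∀ a b : E, seq a b = seq b a → ∀ c : E, seq a (seq b c) = seq (seq a b) c
  comm_seq : ∀ a b c : E, seq c a = seq a c → seq c b = seq b c →
    seq c (seq a b) = seq (seq a b) c
  comm_oplus : ∀ a b c : E, seq c a = seq a c → seq c b = seq b c → ∀ h : perp a b,
    seq c (oplus a b h) = seq (oplus a b h) c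
  scale_seq : ∀ (r : unitInterval) (a b : E), seq (scale r a) b = scale r (seq a b)
  seq_scale : ∀ (r : unitInterval) (a b : E), seq a (scale r b) = scale r (seq a b)

/-- An isomorphism of convex sequential effect algebras with products `seq` and `seq'`. -/
def IsSEAIsomorphism {E : Type u} {F : Type v} [ConvexEffectAlgebra E] [ConvexEffectAlgebra F]
    (seq : E → E → E) (seq' : F → F → F) (φ : E → F) : Prop :=
  IsAffineIsomorphism φ ∧ ∀ a b : E, φ (seq a b) = seq' (φ a) (φ b)

/-- The effect algebra `[0,1] ⊆ ℝ`. -/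
instance unitIntervalEffectAlgebra : EffectAlgebra unitInterval where
  zero := 0
  one := 1
  zero_ne_one := zero_ne_one
  perp a b := (a : ℝ) + (b : ℝ) ≤ 1
  oplus a b h := ⟨(a : ℝ) + (b : ℝ), add_nonneg a.2.1 b.2.1, h⟩
  oplus_comm a b h := ⟨by linarith, Subtype.ext (add_comm _ _)⟩
  oplus_assoc a b c hab h := by
    have ha := a.2.1
    dsimp only at h
    exact ⟨by linarith, by dsimp only; linarith, Subtype.ext (add_assoc _ _ _).symm⟩
  compl a := ⟨1 - (a : ℝ), sub_nonneg.2 a.2.2, by linarith [a.2.1]⟩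
  oplus_compl a := ⟨by dsimp only; linarith, Subtype.ext (by simp)⟩
  compl_unique a b h hb := by
    have := congrArg Subtype.val hb
    apply Subtype.ext
    simp only [Set.Icc.coe_one] at this ⊢
    linarith
  eq_zero_of_perp_one a h := by
    have ha := a.2.1
    apply Subtype.ext
    simp only [Set.Icc.coe_one, Set.Icc.coe_zero] at h ⊢
    linarith

/-- A state is a morphism into `[0,1]`. -/
def IsState {E : Type u} [EffectAlgebra E] (ω : E → unitInterval) : Prop := IsMorphism ω

section Hilbert

variable (H : Type u) [NormedAddCommGroup H] [InnerProductSpace ℂ H]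

/-- The effects on `H`: the operators `A` with `0 ≤ A ≤ I`. -/
def HilbertEffect : Type u := {A : H →L[ℂ] H // 0 ≤ A ∧ A ≤ 1}

variable {H}

open scoped ComplexOrder in
theorem scale_mem_effects [CompleteSpace H] (r : unitInterval) {A : H →L[ℂ] H} (hA : 0 ≤ A ∧ A ≤ 1) :
    0 ≤ ((r : ℝ) : ℂ) • A ∧ ((r : ℝ) : ℂ) • A ≤ 1 := by
  have h0 : (0 : ℂ) ≤ ((r : ℝ) : ℂ) := by exact_mod_cast r.2.1
  have h1 : (0 : ℂ) ≤ ((1 - (r : ℝ) : ℝ) : ℂ) := by exact_mod_cast sub_nonneg.2 r.2.2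
  have hp : A.IsPositive := (ContinuousLinearMap.nonneg_iff_isPositive A).1 hA.1
  have e : ((1 - (r : ℝ) : ℝ) : ℂ) • A = A - ((r : ℝ) : ℂ) • A := by
    push_cast
    rw [sub_smul, one_smul]
  have h2 : 0 ≤ A - ((r : ℝ) : ℂ) • A := by
    rw [← e]
    exact (ContinuousLinearMap.nonneg_iff_isPositive _).2 (hp.smul_of_nonneg h1)
  exact ⟨(ContinuousLinearMap.nonneg_iff_isPositive _).2 (hp.smul_of_nonneg h0),
    (sub_nonneg.1 h2).trans hA.2⟩

/-- The Hilbertian effect algebra of a nonzero complex Hilbert space. -/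
instance hilbertConvexEffectAlgebra [CompleteSpace H] [Nontrivial H] :
    ConvexEffectAlgebra (HilbertEffect H) where
  zero := ⟨0, le_refl _, ContinuousLinearMap.nonneg_iff_isPositive _ |>.2
    ContinuousLinearMap.isPositive_one⟩
  one := ⟨1, ContinuousLinearMap.nonneg_iff_isPositive _ |>.2
    ContinuousLinearMap.isPositive_one, le_refl _⟩
  zero_ne_one h := zero_ne_one (congrArg Subtype.val h)
  perp A B := A.1 + B.1 ≤ 1
  oplus A B h := ⟨A.1 + B.1, add_nonneg A.2.1 B.2.1, h⟩
  oplus_comm A B h := ⟨by rwa [add_comm], Subtype.ext (add_comm _ _)⟩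
  oplus_assoc A B C hab h := by
    have h' : A.1 + (B.1 + C.1) ≤ 1 := by rw [← add_assoc]; exact h
    exact ⟨(le_add_of_nonneg_left A.2.1).trans h', h', Subtype.ext (add_assoc _ _ _).symm⟩
  compl A := ⟨1 - A.1, sub_nonneg.2 A.2.2, sub_le_self _ A.2.1⟩
  oplus_compl A := ⟨(add_sub_cancel A.1 1).le, Subtype.ext (add_sub_cancel A.1 1)⟩
  compl_unique A B h hB := Subtype.ext (eq_sub_of_add_eq' (congrArg Subtype.val hB))
  eq_zero_of_perp_one A h :=
    Subtype.ext (le_antisymm (nonpos_of_add_le_left h) A.2.1)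
  scale r A := ⟨((r : ℝ) : ℂ) • A.1, scale_mem_effects r A.2⟩
  scale_scale α β A := Subtype.ext (by
    change ((α : ℝ) : ℂ) • ((β : ℝ) : ℂ) • A.1 = (((α : ℝ) * (β : ℝ) : ℝ) : ℂ) • A.1
    rw [smul_smul, Complex.ofReal_mul])
  scale_add α β γ A h := by
    have e : ((α : ℝ) : ℂ) • A.1 + ((β : ℝ) : ℂ) • A.1 = ((γ : ℝ) : ℂ) • A.1 := by
      rw [h, ← add_smul]
      push_cast
      rfl
    exact ⟨e.le.trans (scale_mem_effects γ A.2).2, Subtype.ext e.symm⟩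
  scale_oplus r A B h :=
    ⟨(smul_add _ _ _).ge.trans (scale_mem_effects r ⟨add_nonneg A.2.1 B.2.1, h⟩).2,
      Subtype.ext (smul_add _ _ _)⟩
  scale_one A := Subtype.ext (by simp)

end Hilbert

section Contexts

variable {E : Type u} [ConvexEffectAlgebra E]

/-- `a` is a one-dimensional sharp effect. -/
def IsOneDimensional (a : E) : Prop :=
  IsSharp a ∧ a ≠ zero ∧ ∀ b : E, Below b a → ∃ r : unitInterval, b = scale r a

variable (E) in
/-- A context: a finite set of one-dimensional sharp effects with orthogonal sum `1`. -/
structure Context where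
  carrier : Finset E
  oneDimensional : ∀ a ∈ carrier, IsOneDimensional a
  sum_eq_one : IsOrthoSum (fun a : E => a) carrier one

/-- `b` is the orthogonal sum of the effects `r a • a`, where `a` runs over the context `A`. -/
def IsSpectralDecomposition (A : Context E) (r : E → unitInterval) (b : E) : Prop :=
  IsOrthoSum (fun a : E => scale (r a) a) A.carrier b

variable (E) in
def IsSpectral : Prop :=
  ∀ b : E, ∃ (A : Context E) (r : E → unitInterval), IsSpectralDecomposition A r b

/-- The state space of the context `A`: the complex Hilbert space of the formal combinations
`∑ α_a â`, `a ∈ A`, in which the `â` are an orthonormal basis. (As functionals, the states `â` are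
linearly independent because `â(c) = δ_ac` for `a, c ∈ A`.) -/
abbrev StateSpace (A : Context E) : Type u := EuclideanSpace ℂ {a : E // a ∈ A.carrier}

open Classical in
/-- The basis vector `â` of the state space of the context `A`. -/
def stateVector (A : Context E) (a : {a : E // a ∈ A.carrier}) : StateSpace A :=
  EuclideanSpace.single a 1

theorem Context.nonempty (A : Context E) : Nonempty {a : E // a ∈ A.carrier} := by
  have key : ∀ (s : Finset E) (x : E), IsOrthoSum (fun a : E => a) s x → x ≠ zero →
      s.Nonempty := by
    intro s x h hx
    cases h with
    | empty => exact absurd rfl hx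
    | cons i s hi y hy h => exact ⟨i, Finset.mem_cons_self i s⟩
  obtain ⟨a, ha⟩ := key _ _ A.sum_eq_one EffectAlgebra.zero_ne_one.symm
  exact ⟨⟨a, ha⟩⟩

instance stateSpaceNontrivial (A : Context E) : Nontrivial (StateSpace A) := by
  have := A.nonempty
  infer_instance

/-- A choice of a state `â` with `â(a) = 1` for each one-dimensional sharp effect `a`
(`hat a` is irrelevant for the other effects `a`). -/
def IsStateChoice (hat : E → E → unitInterval) : Prop :=
  ∀ a : E, IsOneDimensional a → IsState (hat a) ∧ hat a a = 1

/-- The unitary maps `U A B` make the set of all contexts comparable. -/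
structure IsComparison (hat : E → E → unitInterval)
    (U : (A B : Context E) → StateSpace A ≃ₗᵢ[ℂ] StateSpace B) : Prop where
  self : ∀ A : Context E, U A A = LinearIsometryEquiv.refl ℂ (StateSpace A)
  /-- `U A B` is the adjoint, equivalently the inverse, of `U B A`. -/
  symm : ∀ A B : Context E, U A B = (U B A).symm
  transition : ∀ (A B C : Context E) (a : {a : E // a ∈ A.carrier})
    (c : {c : E // c ∈ C.carrier}),
    ‖inner ℂ (U A B (stateVector A a)) (U C B (stateVector C c))‖ ^ 2
      = ((hat a.1 c.1 : unitInterval) : ℝ)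

/-- The unitary maps `U A B` make the set of all contexts complete: they make it comparable, and
each unit vector of a state space is, up to a phase, the image of some `â`. -/
structure IsCompleteComparison (hat : E → E → unitInterval)
    (U : (A B : Context E) → StateSpace A ≃ₗᵢ[ℂ] StateSpace B) : Prop
    extends IsComparison hat U where
  complete : ∀ (B : Context E) (φ : StateSpace B), ‖φ‖ = 1 →
    ∃ (A : Context E) (a : {a : E // a ∈ A.carrier}) (z : ℂ),
      ‖z‖ = 1 ∧ U A B (stateVector A a) = z • φ

/-- `J` is the map with `J(b) = ∑ r_a P(U_AB â)` whenever `b = ∑ r_a a` over a context `A`, where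
`P(φ)` is the projection onto the line spanned by `φ`. -/
def IsHilbertRepresentation (U : (A B : Context E) → StateSpace A ≃ₗᵢ[ℂ] StateSpace B)
    (B : Context E) (J : E → HilbertEffect (StateSpace B)) : Prop :=
  ∀ (A : Context E) (r : E → unitInterval) (b : E), IsSpectralDecomposition A r b →
    (J b).1 = ∑ a : {a : E // a ∈ A.carrier},
      (((r a.1 : unitInterval) : ℝ) : ℂ) •
        (Submodule.span ℂ {U A B (stateVector A a)}).starProjection

end Contexts

end

/-!
A state is affine, since a bounded additive function on `[0,1]` is linear. Therefore, if
`v A a = U_AB â` is the unit vector belonging to `a ∈ A`, the operator `T` of any spectral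
decomposition of `b` satisfies `⟨T (v A a), v A a⟩ = â(b)`. As every vector is a multiple of some
`v A a`, these numbers determine `T`, so `J` is well defined, and they show that `J` is additive,
affine and unital.

To see that `J` reflects orthogonality, decompose the midpoint `½a ⊕ ½b = ∑ rᵢ aᵢ`. If
`J a + J b ≤ 1`, then `rᵢ ≤ âᵢ(½a ⊕ ½b) ≤ ½`, so the midpoint lies below `½1` and is orthogonal to
itself, which forces `a ⊥ b`. Surjectivity follows, because a positive operator on a
finite-dimensional space is a sum of operators of rank one, and each of these is a multiple of some
`J a`. Finally, the sequential product is transported along the bijection `J`.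
-/

open EffectAlgebra ConvexEffectAlgebra
open InnerProductSpace (rankOne)

noncomputable section

namespace EffectAlgebra

section Sums

variable {E ι : Type*} [EffectAlgebra E] {a b c d x y z : E}

/-- The graph of the partial sum: `a ⊕ b` is defined and equals `c`. Unlike `oplus`, it does not
depend on a proof of orthogonality, so sums can be rewritten and reassociated freely. -/
def IsSum (a b c : E) : Prop := ∃ h : perp a b, oplus a b h = c

theorem isSum_oplus (h : perp a b) : IsSum a b (oplus a b h) := ⟨h, rfl⟩

theorem IsSum.symm (h : IsSum a b c) : IsSum b a c := by
  obtain ⟨hab, rfl⟩ := h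
  exact oplus_comm a b hab

theorem IsSum.unique (hx : IsSum a b x) (hy : IsSum a b y) : x = y := by
  obtain ⟨_, rfl⟩ := hx
  obtain ⟨_, rfl⟩ := hy
  rfl

theorem IsSum.assoc (hx : IsSum a b x) (hy : IsSum x c y) : ∃ z, IsSum b c z ∧ IsSum a z y := by
  obtain ⟨hab, rfl⟩ := hx
  obtain ⟨h, rfl⟩ := hy
  obtain ⟨hbc, h', e⟩ := oplus_assoc a b c hab h
  exact ⟨_, isSum_oplus hbc, h', e⟩

theorem IsSum.interchange (hx : IsSum a b x) (hy : IsSum c d y) (hz : IsSum x y z) :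
    ∃ p q, IsSum a c p ∧ IsSum b d q ∧ IsSum p q z := by
  obtain ⟨w, hbyw, hawz⟩ := hx.assoc hz
  obtain ⟨q, hdbq, hcqw⟩ := hy.assoc hbyw.symm
  obtain ⟨p, hcap, hqpz⟩ := hcqw.symm.assoc hawz.symm
  exact ⟨p, q, hcap.symm, hdbq.symm, hqpz.symm⟩

theorem IsSum.of_below (hz : IsSum c d z) (hac : Below a c) (hbd : Below b d) :
    ∃ x, IsSum a b x ∧ Below x z := by
  obtain ⟨a', hac⟩ := hac
  obtain ⟨b', hbd⟩ := hbd
  obtain ⟨x, y, hx, -, hxy⟩ := IsSum.interchange hac hbd hz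
  exact ⟨x, hx, y, hxy⟩

theorem isSum_compl (a : E) : IsSum a (compl a) one := oplus_compl a

theorem IsSum.eq_compl (h : IsSum a b one) : b = compl a := compl_unique a b h.1 h.2

theorem compl_compl (a : E) : compl (compl a) = a := (isSum_compl a).symm.eq_compl.symm

theorem compl_one : compl (one : E) = zero := eq_zero_of_perp_one _ (isSum_compl one).symm.1

theorem isSum_zero (a : E) : IsSum a zero a := by
  have hone : IsSum (one : E) zero one := compl_one (E := E) ▸ isSum_compl one
  obtain ⟨x, hx, hx'⟩ := (isSum_compl a).symm.assoc hone
  rwa [hx'.eq_compl, compl_compl] at hx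

theorem below_one (a : E) : Below a one := ⟨compl a, isSum_compl a⟩

theorem IsOrthoSum.exists_erase [DecidableEq ι] {f : ι → E} {s : Finset ι}
    (h : IsOrthoSum f s x) {i : ι} (hi : i ∈ s) :
    ∃ y, IsOrthoSum f (s.erase i) y ∧ IsSum (f i) y x := by
  induction h with
  | empty => simp at hi
  | cons j s hj x hx hjx ih =>
    rcases eq_or_ne i j with rfl | hij
    · exact ⟨x, by rwa [Finset.erase_cons], isSum_oplus hjx⟩
    · obtain ⟨y, hy, hiyx⟩ := ih ((Finset.mem_cons.1 hi).resolve_left hij)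
      obtain ⟨w, hyjw, hiw⟩ := hiyx.assoc (isSum_oplus hjx).symm
      obtain ⟨hjy, rfl⟩ := hyjw.symm
      refine ⟨_, ?_, hiw⟩
      rw [Finset.erase_cons_of_ne hj hij.symm]
      exact .cons j (s.erase i) (fun h => hj (Finset.mem_of_mem_erase h)) y hy hjy

theorem IsOrthoSum.mono {f g : ι → E} {s : Finset ι} (hf : IsOrthoSum f s x)
    (hg : IsOrthoSum g s y) (hfg : ∀ i ∈ s, Below (f i) (g i)) : Below x y := by
  classical
  induction hf generalizing y with
  | empty => exact ⟨y, (isSum_zero y).symm⟩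
  | cons i s hi x _ hix ih =>
    obtain ⟨y', hy', hsum⟩ := hg.exists_erase (Finset.mem_cons_self i s)
    rw [Finset.erase_cons] at hy'
    have hxy' := ih hy' fun j hj => hfg j (Finset.mem_cons_of_mem hj)
    obtain ⟨w, hw, hwy⟩ := hsum.of_below (hfg i (Finset.mem_cons_self i s)) hxy'
    rwa [(isSum_oplus hix).unique hw]

end Sums

section Morphisms

variable {E F : Type*} [EffectAlgebra E] [EffectAlgebra F] {φ : E → F}

theorem isAdditive_iff : IsAdditive φ ↔ ∀ a b c, IsSum a b c → IsSum (φ a) (φ b) (φ c) := by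
  constructor
  · rintro h a b _ ⟨hab, rfl⟩
    obtain ⟨h', e⟩ := h a b hab
    exact ⟨h', e.symm⟩
  · intro h a b hab
    obtain ⟨h', e⟩ := h a b _ (isSum_oplus hab)
    exact ⟨h', e.symm⟩

theorem IsMorphism.map_isSum (hφ : IsMorphism φ) {a b c : E} (h : IsSum a b c) :
    IsSum (φ a) (φ b) (φ c) :=
  isAdditive_iff.1 hφ.1 a b c h

theorem IsMorphism.map_compl (hφ : IsMorphism φ) (a : E) : φ (compl a) = compl (φ a) :=
  IsSum.eq_compl (hφ.2 ▸ hφ.map_isSum (isSum_compl a))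

theorem IsMorphism.map_zero (hφ : IsMorphism φ) : φ zero = zero := by
  rw [← compl_one, hφ.map_compl, hφ.2, compl_one]

theorem IsMonomorphism.eq_one_of_map_eq_one (hφ : IsMonomorphism φ) {a : E} (h : φ a = one) :
    a = one := by
  have hzero : φ (compl a) = zero := by rw [hφ.1.map_compl, h, compl_one]
  have hperp : perp (compl a) one := hφ.2 _ _ <| by
    rw [hzero, hφ.1.2]
    exact (isSum_zero one).symm.1
  rw [← compl_compl a, eq_zero_of_perp_one _ hperp, ← compl_one, compl_compl]

theorem IsMonomorphism.injective (hφ : IsMonomorphism φ) : Function.Injective φ := by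
  intro a b hab
  have hone : IsSum (φ a) (φ (compl b)) one := by
    rw [hab, hφ.1.map_compl]
    exact isSum_compl _
  have hsum := isSum_oplus (hφ.2 a (compl b) hone.1)
  rw [hφ.eq_one_of_map_eq_one ((hφ.1.map_isSum hsum).unique hone)] at hsum
  rw [hsum.symm.eq_compl, compl_compl]

end Morphisms

section Scaling

variable {E ι : Type*} [ConvexEffectAlgebra E] {a b c : E}

theorem IsSum.scale (r : unitInterval) (h : IsSum a b c) :
    IsSum (scale r a) (scale r b) (scale r c) := by
  obtain ⟨hab, rfl⟩ := h
  obtain ⟨h', e⟩ := scale_oplus r a b hab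
  exact ⟨h', e.symm⟩

theorem isSum_scale {α β γ : unitInterval} (h : (γ : ℝ) = α + β) (a : E) :
    IsSum (scale α a) (scale β a) (scale γ a) := by
  obtain ⟨h', e⟩ := scale_add α β γ a h
  exact ⟨h', e.symm⟩

theorem below_scale {r s : unitInterval} (h : r ≤ s) (a : E) : Below (scale r a) (scale s a) :=
  ⟨scale ⟨s - r, sub_nonneg.2 h, by linarith [s.2.2, r.2.1]⟩ a, isSum_scale (by simp) a⟩

theorem Below.scale (r : unitInterval) (h : Below a b) : Below (scale r a) (scale r b) := by
  obtain ⟨c, h⟩ := h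
  exact ⟨_, IsSum.scale r h⟩

theorem zero_scale (a : E) : scale 0 a = zero := by
  have hself : IsSum (scale 0 a) a a := by
    simpa only [scale_one] using isSum_scale (α := 0) (β := 1) (γ := 1) (by simp) a
  obtain ⟨x, hx, hx'⟩ := hself.assoc (isSum_compl a)
  rw [hx.unique (isSum_compl a)] at hx'
  exact eq_zero_of_perp_one _ hx'.1

theorem scale_zero (r : unitInterval) : scale r (zero : E) = zero := by
  rw [← zero_scale (zero : E), scale_scale, mul_zero]

theorem IsOrthoSum.scale (r : unitInterval) {f : ι → E} {s : Finset ι} (h : IsOrthoSum f s a) :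
    IsOrthoSum (fun i => scale r (f i)) s (scale r a) := by
  induction h with
  | empty => rw [scale_zero]; exact .empty
  | cons i s hi x _ hix ih =>
    obtain ⟨h', e⟩ := scale_oplus r _ _ hix
    rw [e]
    exact .cons i s hi _ ih h'

/-- The scalar `1 / 2`, with which midpoints of effects are formed. -/
def half : unitInterval := ⟨1 / 2, by norm_num, by norm_num⟩

theorem coe_half : (half : ℝ) = 1 / 2 := rfl

theorem isSum_half (a : E) : IsSum (scale half a) (scale half a) a := by
  have h := isSum_scale (α := half) (β := half) (γ := 1) (by rw [coe_half]; norm_num) a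
  rwa [scale_one] at h

theorem exists_isSum_half (a b : E) : ∃ c, IsSum (scale half a) (scale half b) c := by
  obtain ⟨c, hc, -⟩ :=
    (isSum_half one).of_below ((below_one a).scale half) ((below_one b).scale half)
  exact ⟨c, hc⟩

theorem perp_of_isSum_half (hc : IsSum (scale half a) (scale half b) c) (hcc : perp c c) :
    perp a b := by
  obtain ⟨p, q, hp, hq, hpq⟩ := hc.interchange hc (isSum_oplus hcc)
  rw [hp.unique (isSum_half a), hq.unique (isSum_half b)] at hpq
  exact hpq.1

theorem perp_self_of_below_half (h : Below c (scale half one)) : perp c c := by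
  obtain ⟨_, hx, -⟩ := (isSum_half one).of_below h h
  exact hx.1

end Scaling

end EffectAlgebra

theorem eq_mul_of_additive_of_bounded {f : unitInterval → ℝ} {C : ℝ}
    (hadd : ∀ α β γ : unitInterval, (γ : ℝ) = α + β → f γ = f α + f β)
    (hbound : ∀ r, |f r| ≤ C) (r : unitInterval) : f r = r * f 1 := by
  let d : unitInterval → ℝ := fun r => f r - r * f 1
  have d_add (α β γ : unitInterval) (h : (γ : ℝ) = α + β) : d γ = d α + d β := by
    simp only [d, hadd α β γ h, h]
    ring
  have d_symm (r : unitInterval) : d (unitInterval.symm r) = -d r := by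
    have h := d_add r (unitInterval.symm r) 1 (by simp)
    have hd : d 1 = 0 := by simp [d]
    linarith
  -- The tent map doubles `|d|`, so a nonzero value of `d` would make it unbounded.
  have d_tent (r : unitInterval) : ∃ s, |d s| = 2 * |d r| := by
    rcases le_total (r : ℝ) (1 / 2) with hr | hr
    · refine ⟨⟨2 * r, by linarith [r.2.1], by linarith⟩, ?_⟩
      rw [d_add r r _ (two_mul _), ← two_mul, abs_mul, abs_two]
    · refine ⟨⟨2 * (1 - r), by linarith [r.2.2], by linarith⟩, ?_⟩
      rw [d_add (unitInterval.symm r) (unitInterval.symm r) _ (two_mul _), ← two_mul, d_symm,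
        abs_mul, abs_two, abs_neg]
  have d_bound (r : unitInterval) : |d r| ≤ C + |f 1| := by
    refine (abs_sub _ _).trans (add_le_add (hbound r) ?_)
    rw [abs_mul, abs_of_nonneg r.2.1]
    exact mul_le_of_le_one_left (abs_nonneg _) r.2.2
  have d_pow (n : ℕ) : ∀ r, 2 ^ n * |d r| ≤ C + |f 1| := by
    induction n with
    | zero => simpa using d_bound
    | succ n ih =>
      intro r
      obtain ⟨s, hs⟩ := d_tent r
      rw [pow_succ, mul_assoc, ← hs]
      exact ih s
  by_contra hne
  have hpos : 0 < |d r| := abs_pos.2 (sub_ne_zero.2 hne)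
  obtain ⟨n, hn⟩ := pow_unbounded_of_one_lt ((C + |f 1|) / |d r|) one_lt_two
  exact ((div_lt_iff₀ hpos).1 hn).not_ge (d_pow n r)

section States

variable {E ι : Type*}

theorem EffectAlgebra.IsSum.coe_add {r s t : unitInterval} (h : IsSum r s t) : (r : ℝ) + s = t :=
  congrArg Subtype.val h.2

theorem IsState.map_isSum [EffectAlgebra E] {ω : E → unitInterval} (hω : IsState ω) {a b c : E}
    (h : IsSum a b c) : (ω a : ℝ) + ω b = ω c :=
  (IsMorphism.map_isSum hω h).coe_add

theorem IsState.map_one [EffectAlgebra E] {ω : E → unitInterval} (hω : IsState ω) :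
    (ω one : ℝ) = 1 :=
  congrArg Subtype.val hω.2

theorem IsState.map_isOrthoSum [EffectAlgebra E] {ω : E → unitInterval} (hω : IsState ω)
    {f : ι → E} {s : Finset ι} {x : E} (h : IsOrthoSum f s x) :
    (ω x : ℝ) = ∑ i ∈ s, (ω (f i) : ℝ) := by
  induction h with
  | empty => exact congrArg Subtype.val (IsMorphism.map_zero hω)
  | cons i s hi x _ h ih => rw [Finset.sum_cons, ← ih, hω.map_isSum (isSum_oplus h)]

variable [ConvexEffectAlgebra E] {ω : E → unitInterval}

theorem IsState.map_scale (hω : IsState ω) (r : unitInterval) (a : E) :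
    (ω (scale r a) : ℝ) = r * ω a := by
  have h := eq_mul_of_additive_of_bounded (f := fun r => (ω (scale r a) : ℝ)) (C := 1)
    (fun α β γ h => (hω.map_isSum (isSum_scale h a)).symm)
    (fun r => abs_le.2 ⟨by linarith [(ω (scale r a)).2.1], (ω (scale r a)).2.2⟩) r
  rwa [scale_one] at h

theorem IsState.map_isSpectralDecomposition (hω : IsState ω) {A : Context E}
    {r : E → unitInterval} {b : E} (h : IsSpectralDecomposition A r b) :
    (ω b : ℝ) = ∑ a ∈ A.carrier, (r a : ℝ) * ω a := by
  simp only [hω.map_isOrthoSum h, hω.map_scale]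

theorem IsStateChoice.isState {hat : E → E → unitInterval} (hhat : IsStateChoice hat)
    {A : Context E} (a : {a : E // a ∈ A.carrier}) : IsState (hat a.1) :=
  (hhat a.1 (A.oneDimensional a.1 a.2)).1

theorem IsStateChoice.apply_self {hat : E → E → unitInterval} (hhat : IsStateChoice hat)
    {A : Context E} (a : {a : E // a ∈ A.carrier}) : (hat a.1 a.1 : ℝ) = 1 :=
  congrArg Subtype.val (hhat a.1 (A.oneDimensional a.1 a.2)).2

theorem IsSpectralDecomposition.coeff_le {hat : E → E → unitInterval} (hhat : IsStateChoice hat)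
    {A : Context E} {r : E → unitInterval} {b : E} (h : IsSpectralDecomposition A r b)
    (a : {a : E // a ∈ A.carrier}) : r a.1 ≤ hat a.1 b := by
  change (r a.1 : ℝ) ≤ hat a.1 b
  calc (r a.1 : ℝ) = r a.1 * hat a.1 a.1 := by rw [hhat.apply_self a, mul_one]
    _ ≤ ∑ c ∈ A.carrier, (r c : ℝ) * hat a.1 c :=
      Finset.single_le_sum (f := fun c => (r c : ℝ) * hat a.1 c)
        (fun c _ => mul_nonneg (r c).2.1 (hat a.1 c).2.1) a.2
    _ = hat a.1 b := ((hhat.isState a).map_isSpectralDecomposition h).symm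

theorem IsSpectralDecomposition.below_scale_one {A : Context E} {r : E → unitInterval} {b : E}
    (h : IsSpectralDecomposition A r b) {s : unitInterval} (hr : ∀ a ∈ A.carrier, r a ≤ s) :
    Below b (scale s one) :=
  IsOrthoSum.mono h (A.sum_eq_one.scale s) fun a ha => below_scale (hr a ha) a

theorem IsSpectral.perp_of_add_le_one (hspectral : IsSpectral E) {hat : E → E → unitInterval}
    (hhat : IsStateChoice hat) {a b : E}
    (h : ∀ (A : Context E) (x : {x : E // x ∈ A.carrier}), (hat x.1 a : ℝ) + hat x.1 b ≤ 1) :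
    perp a b := by
  obtain ⟨c, hc⟩ := exists_isSum_half a b
  obtain ⟨A, r, hr⟩ := hspectral c
  refine perp_of_isSum_half hc (perp_self_of_below_half (hr.below_scale_one fun x hx => ?_))
  have hsum := (hhat.isState ⟨x, hx⟩).map_isSum hc
  simp only [(hhat.isState ⟨x, hx⟩).map_scale, coe_half] at hsum
  have hle : (hat x c : ℝ) ≤ half := by
    rw [coe_half]
    linarith [h A ⟨x, hx⟩]
  exact (hr.coeff_le hhat ⟨x, hx⟩).trans hle

end States

section Operators

variable {H : Type*} [NormedAddCommGroup H] [InnerProductSpace ℂ H]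

theorem starProjection_span_singleton_eq_rankOne {x : H} (hx : ‖x‖ = 1) :
    (Submodule.span ℂ {x}).starProjection = rankOne ℂ x x := by
  ext y
  rw [Submodule.starProjection_unit_singleton ℂ hx, InnerProductSpace.rankOne_apply]

theorem rankOne_smul_self (c : ℂ) (x : H) :
    rankOne ℂ (c • x) (c • x) = ((‖c‖ ^ 2 : ℝ) : ℂ) • rankOne ℂ x x := by
  ext y
  simp only [InnerProductSpace.rankOne_apply, smul_apply, inner_smul_left, smul_smul]
  rw [mul_right_comm, Complex.conj_mul', Complex.ofReal_pow]

theorem reApplyInnerSelf_rankOne (x y : H) :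
    (rankOne ℂ x x).reApplyInnerSelf y = ‖inner ℂ y x‖ ^ 2 := by
  rw [ContinuousLinearMap.reApplyInnerSelf_apply, InnerProductSpace.rankOne_apply, inner_smul_left,
    Complex.conj_mul', norm_inner_symm]
  norm_cast

theorem reApplyInnerSelf_add (S T : H →L[ℂ] H) (x : H) :
    (S + T).reApplyInnerSelf x = S.reApplyInnerSelf x + T.reApplyInnerSelf x := by
  simp [ContinuousLinearMap.reApplyInnerSelf_apply, inner_add_left]

theorem reApplyInnerSelf_ofReal_smul (r : ℝ) (T : H →L[ℂ] H) (x : H) :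
    ((r : ℂ) • T).reApplyInnerSelf x = r * T.reApplyInnerSelf x := by
  rw [ContinuousLinearMap.reApplyInnerSelf_apply, smul_apply, inner_smul_left, Complex.conj_ofReal]
  exact Complex.re_ofReal_mul _ _

theorem reApplyInnerSelf_sum {ι : Type*} (s : Finset ι) (T : ι → H →L[ℂ] H) (x : H) :
    (∑ i ∈ s, T i).reApplyInnerSelf x = ∑ i ∈ s, (T i).reApplyInnerSelf x := by
  simp [ContinuousLinearMap.reApplyInnerSelf_apply, sum_inner]

theorem reApplyInnerSelf_one {x : H} (hx : ‖x‖ = 1) :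
    (1 : H →L[ℂ] H).reApplyInnerSelf x = 1 := by
  simp [ContinuousLinearMap.reApplyInnerSelf_apply, inner_self_eq_norm_sq_to_K, hx]

theorem reApplyInnerSelf_mono {S T : H →L[ℂ] H} (h : S ≤ T) (x : H) :
    S.reApplyInnerSelf x ≤ T.reApplyInnerSelf x := by
  have hpos := ((ContinuousLinearMap.le_def S T).1 h).2 x
  have hadd := reApplyInnerSelf_add S (T - S) x
  rw [add_sub_cancel] at hadd
  linarith

theorem HilbertEffect.isSelfAdjoint [CompleteSpace H] (T : HilbertEffect H) : IsSelfAdjoint T.1 :=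
  ((ContinuousLinearMap.nonneg_iff_isPositive _).1 T.2.1).isSelfAdjoint

theorem HilbertEffect.isSum_iff [CompleteSpace H] [Nontrivial H] {S T R : HilbertEffect H} :
    IsSum S T R ↔ S.1 + T.1 = R.1 :=
  ⟨fun h => congrArg Subtype.val h.2, fun h => ⟨h.le.trans R.2.2, Subtype.ext h⟩⟩

end Operators

section Representation

variable {E H : Type*} [ConvexEffectAlgebra E] [NormedAddCommGroup H] [InnerProductSpace ℂ H]
  {hat : E → E → unitInterval} {v : (A : Context E) → {a : E // a ∈ A.carrier} → H}

/-- The vectors `v A a ∈ H` represent the states `â`: their transition probabilities are the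
numbers `â(c)`, and each unit vector of `H` is one of them up to a phase. For a complete set of
contexts with unitary maps `U`, the vectors `U_AB â` form such a system in the state space of `B`.
-/
structure IsCompleteVectorSystem (hat : E → E → unitInterval)
    (v : (A : Context E) → {a : E // a ∈ A.carrier} → H) : Prop where
  transition : ∀ (A C : Context E) (a : {a : E // a ∈ A.carrier}) (c : {c : E // c ∈ C.carrier}),
    ‖inner ℂ (v A a) (v C c)‖ ^ 2 = (hat a.1 c.1 : ℝ)
  complete : ∀ x : H, ‖x‖ = 1 →
    ∃ (A : Context E) (a : {a : E // a ∈ A.carrier}) (z : ℂ), ‖z‖ = 1 ∧ v A a = z • x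

/-- The operator `∑ r_a P(v A a)`, which represents the effect `∑ r_a a`. -/
def spectralOperator (v : (A : Context E) → {a : E // a ∈ A.carrier} → H) (A : Context E)
    (r : E → unitInterval) : H →L[ℂ] H :=
  ∑ a : {a : E // a ∈ A.carrier}, (((r a.1 : unitInterval) : ℝ) : ℂ) •
    (Submodule.span ℂ {v A a}).starProjection

/-- `J` maps `∑ r_a a` to `∑ r_a P(v A a)` for all contexts `A`. This is `IsHilbertRepresentation`
for vectors `v A a` in an arbitrary Hilbert space. -/
def IsVectorRepresentation (v : (A : Context E) → {a : E // a ∈ A.carrier} → H)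
    (J : E → HilbertEffect H) : Prop :=
  ∀ (A : Context E) (r : E → unitInterval) (b : E), IsSpectralDecomposition A r b →
    (J b).1 = spectralOperator v A r

theorem IsCompleteComparison.isCompleteVectorSystem
    {U : (A B : Context E) → StateSpace A ≃ₗᵢ[ℂ] StateSpace B} (hU : IsCompleteComparison hat U)
    (B : Context E) : IsCompleteVectorSystem hat fun A a => U A B (stateVector A a) :=
  ⟨fun A C => hU.transition A B C, hU.complete B⟩

namespace IsCompleteVectorSystem

theorem norm_eq_one (hv : IsCompleteVectorSystem hat v) (hhat : IsStateChoice hat)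
    (A : Context E) (a : {a : E // a ∈ A.carrier}) : ‖v A a‖ = 1 := by
  have h := hv.transition A A a a
  rw [hhat.apply_self a, inner_self_eq_norm_sq_to_K, norm_pow, RCLike.norm_ofReal, abs_norm,
    ← pow_mul] at h
  exact (pow_eq_one_iff_of_nonneg (norm_nonneg _) (by norm_num)).1 h

theorem exists_eq_smul [Nontrivial H] (hv : IsCompleteVectorSystem hat v) (x : H) :
    ∃ (A : Context E) (a : {a : E // a ∈ A.carrier}) (c : ℂ), x = c • v A a := by
  rcases eq_or_ne x 0 with rfl | hx
  · obtain ⟨y, hy⟩ := exists_norm_eq H zero_le_one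
    obtain ⟨A, a, -⟩ := hv.complete y hy
    exact ⟨A, a, 0, (zero_smul ℂ _).symm⟩
  · have hnorm : (‖x‖ : ℂ) ≠ 0 := Complex.ofReal_ne_zero.2 (norm_ne_zero_iff.2 hx)
    obtain ⟨A, a, z, hz, h⟩ := hv.complete ((‖x‖ : ℂ)⁻¹ • x) (norm_smul_inv_norm hx)
    have hz0 : z ≠ 0 := norm_ne_zero_iff.1 (hz ▸ one_ne_zero)
    refine ⟨A, a, ‖x‖ * z⁻¹, ?_⟩
    rw [h, smul_smul, smul_smul, inv_mul_cancel_right₀ hz0, mul_inv_cancel₀ hnorm, one_smul]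

theorem finiteDimensional [Nontrivial H] (hv : IsCompleteVectorSystem hat v)
    (hhat : IsStateChoice hat) : FiniteDimensional ℂ H := by
  obtain ⟨A, -⟩ := hv.exists_eq_smul 0
  have hspan : (Submodule.span ℂ (Set.range (v A)))ᗮ = ⊥ := by
    refine (Submodule.eq_bot_iff _).2 fun x hx => ?_
    obtain ⟨D, d, c, rfl⟩ := hv.exists_eq_smul x
    by_contra hne
    have hc : c ≠ 0 := left_ne_zero_of_smul hne
    have hzero (a : {a : E // a ∈ A.carrier}) : (hat d.1 a.1 : ℝ) = 0 := by
      have h := Submodule.inner_left_of_mem_orthogonal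
        (Submodule.subset_span (Set.mem_range_self a)) hx
      rw [inner_smul_left, mul_eq_zero_iff_left ((map_ne_zero _).2 hc)] at h
      rw [← hv.transition D A d a, h, norm_zero, zero_pow two_ne_zero]
    have hsum := (hhat.isState d).map_isOrthoSum A.sum_eq_one
    rw [(hhat.isState d).map_one, Finset.sum_eq_zero fun a ha => hzero ⟨a, ha⟩] at hsum
    exact one_ne_zero hsum
  have := FiniteDimensional.span_of_finite ℂ (Set.finite_range (v A))
  refine Module.finite_def.2 ?_
  rw [← Submodule.orthogonal_eq_bot_iff.1 hspan]
  exact Submodule.fg_span (Set.finite_range (v A))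

variable [CompleteSpace H] [Nontrivial H]

theorem le_of_reApplyInnerSelf_le (hv : IsCompleteVectorSystem hat v) {S T : H →L[ℂ] H}
    (hS : IsSelfAdjoint S) (hT : IsSelfAdjoint T)
    (h : ∀ A a, S.reApplyInnerSelf (v A a) ≤ T.reApplyInnerSelf (v A a)) : S ≤ T := by
  refine ContinuousLinearMap.isPositive_def'.2 ⟨hT.sub hS, fun x => ?_⟩
  obtain ⟨A, a, c, rfl⟩ := hv.exists_eq_smul x
  have hadd := reApplyInnerSelf_add S (T - S) (v A a)
  rw [add_sub_cancel] at hadd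
  rw [ContinuousLinearMap.reApplyInnerSelf_smul]
  exact mul_nonneg (sq_nonneg _) (by linarith [h A a])

theorem eq_of_reApplyInnerSelf_eq (hv : IsCompleteVectorSystem hat v) {S T : H →L[ℂ] H}
    (hS : IsSelfAdjoint S) (hT : IsSelfAdjoint T)
    (h : ∀ A a, S.reApplyInnerSelf (v A a) = T.reApplyInnerSelf (v A a)) : S = T :=
  le_antisymm (hv.le_of_reApplyInnerSelf_le hS hT fun A a => (h A a).le)
    (hv.le_of_reApplyInnerSelf_le hT hS fun A a => (h A a).ge)

end IsCompleteVectorSystem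

theorem isSelfAdjoint_spectralOperator [CompleteSpace H] (A : Context E) (r : E → unitInterval) :
    IsSelfAdjoint (spectralOperator v A r) :=
  isSelfAdjoint_sum _ fun _ _ =>
    IsSelfAdjoint.smul (Complex.conj_ofReal _) (isSelfAdjoint_starProjection _)

theorem IsSpectralDecomposition.reApplyInnerSelf_spectralOperator
    (hv : IsCompleteVectorSystem hat v) (hhat : IsStateChoice hat) {A : Context E}
    {r : E → unitInterval} {b : E} (hb : IsSpectralDecomposition A r b) (D : Context E)
    (d : {d : E // d ∈ D.carrier}) :
    (spectralOperator v A r).reApplyInnerSelf (v D d) = hat d.1 b := by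
  simp only [spectralOperator, reApplyInnerSelf_sum, reApplyInnerSelf_ofReal_smul,
    starProjection_span_singleton_eq_rankOne (hv.norm_eq_one hhat A _), reApplyInnerSelf_rankOne,
    hv.transition]
  rw [(hhat.isState d).map_isSpectralDecomposition hb,
    Finset.sum_coe_sort A.carrier fun a => (r a : ℝ) * hat d.1 a]

theorem IsSpectralDecomposition.spectralOperator_mem_effects [CompleteSpace H] [Nontrivial H]
    (hv : IsCompleteVectorSystem hat v) (hhat : IsStateChoice hat) {A : Context E}
    {r : E → unitInterval} {b : E} (hb : IsSpectralDecomposition A r b) :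
    0 ≤ spectralOperator v A r ∧ spectralOperator v A r ≤ 1 := by
  have hT := isSelfAdjoint_spectralOperator (v := v) A r
  constructor
  · refine hv.le_of_reApplyInnerSelf_le (.zero _) hT fun D d => ?_
    rw [hb.reApplyInnerSelf_spectralOperator hv hhat, ContinuousLinearMap.reApplyInnerSelf_apply,
      zero_apply, inner_zero_left, map_zero]
    exact (hat d.1 b).2.1
  · refine hv.le_of_reApplyInnerSelf_le hT (.one _) fun D d => ?_
    rw [hb.reApplyInnerSelf_spectralOperator hv hhat,
      reApplyInnerSelf_one (hv.norm_eq_one hhat D d)]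
    exact (hat d.1 b).2.2

theorem IsCompleteVectorSystem.existsUnique_isVectorRepresentation [CompleteSpace H] [Nontrivial H]
    (hv : IsCompleteVectorSystem hat v) (hhat : IsStateChoice hat) (hspectral : IsSpectral E) :
    ∃! J : E → HilbertEffect H, IsVectorRepresentation v J := by
  choose A r hb using hspectral
  refine ⟨fun b => ⟨spectralOperator v (A b) (r b), (hb b).spectralOperator_mem_effects hv hhat⟩,
    fun C s b hs => ?_, fun J hJ => funext fun b => Subtype.ext (hJ (A b) (r b) b (hb b))⟩
  refine hv.eq_of_reApplyInnerSelf_eq (isSelfAdjoint_spectralOperator _ _)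
    (isSelfAdjoint_spectralOperator _ _) fun D d => ?_
  rw [(hb b).reApplyInnerSelf_spectralOperator hv hhat,
    hs.reApplyInnerSelf_spectralOperator hv hhat]

namespace IsVectorRepresentation

variable {J : E → HilbertEffect H}

theorem reApplyInnerSelf_apply (hJ : IsVectorRepresentation v J) (hspectral : IsSpectral E)
    (hv : IsCompleteVectorSystem hat v) (hhat : IsStateChoice hat) (b : E) (D : Context E)
    (d : {d : E // d ∈ D.carrier}) : (J b).1.reApplyInnerSelf (v D d) = hat d.1 b := by
  obtain ⟨A, r, hb⟩ := hspectral b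
  rw [hJ A r b hb, hb.reApplyInnerSelf_spectralOperator hv hhat]

variable [CompleteSpace H] [Nontrivial H]

theorem isMorphism (hJ : IsVectorRepresentation v J) (hspectral : IsSpectral E)
    (hv : IsCompleteVectorSystem hat v) (hhat : IsStateChoice hat) : IsMorphism J := by
  have hval := hJ.reApplyInnerSelf_apply hspectral hv hhat
  constructor
  · refine isAdditive_iff.2 fun a b c h => HilbertEffect.isSum_iff.2 ?_
    refine hv.eq_of_reApplyInnerSelf_eq ((J a).isSelfAdjoint.add (J b).isSelfAdjoint)
      (J c).isSelfAdjoint fun D d => ?_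
    rw [reApplyInnerSelf_add, hval, hval, hval, (hhat.isState d).map_isSum h]
  · refine Subtype.ext (hv.eq_of_reApplyInnerSelf_eq (J one).isSelfAdjoint (.one _) fun D d => ?_)
    rw [hval, (hhat.isState d).map_one]
    exact (reApplyInnerSelf_one (hv.norm_eq_one hhat D d)).symm

theorem map_scale (hJ : IsVectorRepresentation v J) (hspectral : IsSpectral E)
    (hv : IsCompleteVectorSystem hat v) (hhat : IsStateChoice hat) (r : unitInterval) (a : E) :
    J (scale r a) = scale r (J a) := by
  have hval := hJ.reApplyInnerSelf_apply hspectral hv hhat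
  refine Subtype.ext (hv.eq_of_reApplyInnerSelf_eq (J (scale r a)).isSelfAdjoint
    (HilbertEffect.isSelfAdjoint _) fun D d => ?_)
  change _ = (((r : ℝ) : ℂ) • (J a).1).reApplyInnerSelf (v D d)
  rw [reApplyInnerSelf_ofReal_smul, hval, hval, (hhat.isState d).map_scale]

theorem isMonomorphism (hJ : IsVectorRepresentation v J) (hspectral : IsSpectral E)
    (hv : IsCompleteVectorSystem hat v) (hhat : IsStateChoice hat) : IsMonomorphism J := by
  refine ⟨hJ.isMorphism hspectral hv hhat, fun a b hab => ?_⟩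
  refine hspectral.perp_of_add_le_one hhat fun D d => ?_
  have hle := reApplyInnerSelf_mono hab (v D d)
  rwa [reApplyInnerSelf_add, reApplyInnerSelf_one (hv.norm_eq_one hhat D d),
    hJ.reApplyInnerSelf_apply hspectral hv hhat,
    hJ.reApplyInnerSelf_apply hspectral hv hhat] at hle

theorem coe_apply_eq_rankOne (hJ : IsVectorRepresentation v J) (hspectral : IsSpectral E)
    (hv : IsCompleteVectorSystem hat v) (hhat : IsStateChoice hat) {A : Context E}
    (a : {a : E // a ∈ A.carrier}) : (J a.1).1 = rankOne ℂ (v A a) (v A a) := by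
  refine hv.eq_of_reApplyInnerSelf_eq (J a.1).isSelfAdjoint
    (InnerProductSpace.isPositive_rankOne_self _).isSelfAdjoint fun D d => ?_
  rw [hJ.reApplyInnerSelf_apply hspectral hv hhat, reApplyInnerSelf_rankOne, hv.transition]

theorem exists_coe_apply_eq_rankOne (hJ : IsVectorRepresentation v J) (hspectral : IsSpectral E)
    (hv : IsCompleteVectorSystem hat v) (hhat : IsStateChoice hat) {x : H}
    (hx : rankOne ℂ x x ≤ 1) : ∃ a, (J a).1 = rankOne ℂ x x := by
  obtain ⟨A, a, c, rfl⟩ := hv.exists_eq_smul x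
  rw [rankOne_smul_self] at hx ⊢
  have hc := reApplyInnerSelf_mono hx (v A a)
  rw [reApplyInnerSelf_ofReal_smul, reApplyInnerSelf_rankOne, hv.transition, hhat.apply_self,
    reApplyInnerSelf_one (hv.norm_eq_one hhat A a), mul_one] at hc
  refine ⟨scale ⟨‖c‖ ^ 2, sq_nonneg _, hc⟩ a.1, ?_⟩
  rw [hJ.map_scale hspectral hv hhat, ← hJ.coe_apply_eq_rankOne hspectral hv hhat]
  rfl

theorem exists_coe_apply_eq_sum_rankOne (hJ : IsVectorRepresentation v J)
    (hspectral : IsSpectral E) (hv : IsCompleteVectorSystem hat v) (hhat : IsStateChoice hat)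
    {ι : Type*} (u : ι → H) (s : Finset ι) (hs : ∑ i ∈ s, rankOne ℂ (u i) (u i) ≤ 1) :
    ∃ a, (J a).1 = ∑ i ∈ s, rankOne ℂ (u i) (u i) := by
  have hpos (i : ι) : 0 ≤ rankOne ℂ (u i) (u i) :=
    (ContinuousLinearMap.nonneg_iff_isPositive _).2
      (InnerProductSpace.isPositive_rankOne_self _)
  have hmono := hJ.isMonomorphism hspectral hv hhat
  induction s using Finset.cons_induction with
  | empty => exact ⟨zero, by rw [hmono.1.map_zero]; rfl⟩
  | cons i s hi ih =>
    rw [Finset.sum_cons] at hs ⊢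
    have hsum : 0 ≤ ∑ i ∈ s, rankOne ℂ (u i) (u i) := Finset.sum_nonneg fun i _ => hpos i
    obtain ⟨a, ha⟩ := hJ.exists_coe_apply_eq_rankOne hspectral hv hhat
      ((le_add_of_nonneg_right hsum).trans hs)
    obtain ⟨b, hb⟩ := ih ((le_add_of_nonneg_left (hpos i)).trans hs)
    rw [← ha, ← hb] at hs ⊢
    exact ⟨_, (HilbertEffect.isSum_iff.1 (hmono.1.map_isSum (isSum_oplus (hmono.2 a b hs)))).symm⟩

theorem surjective (hJ : IsVectorRepresentation v J) (hspectral : IsSpectral E)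
    (hv : IsCompleteVectorSystem hat v) (hhat : IsStateChoice hat) : Function.Surjective J := by
  rintro ⟨T, hT, hT'⟩
  have := hv.finiteDimensional hhat
  obtain ⟨m, u, rfl⟩ := ContinuousLinearMap.isPositive_iff_eq_sum_rankOne.1
    ((ContinuousLinearMap.nonneg_iff_isPositive _).1 hT)
  obtain ⟨a, ha⟩ := hJ.exists_coe_apply_eq_sum_rankOne hspectral hv hhat u Finset.univ hT'
  exact ⟨a, Subtype.ext ha⟩

theorem isAffineIsomorphism (hJ : IsVectorRepresentation v J) (hspectral : IsSpectral E)
    (hv : IsCompleteVectorSystem hat v) (hhat : IsStateChoice hat) : IsAffineIsomorphism J :=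
  ⟨⟨hJ.isMonomorphism hspectral hv hhat, hJ.surjective hspectral hv hhat⟩,
    hJ.map_scale hspectral hv hhat⟩

end IsVectorRepresentation

end Representation

section Transport

variable {E F : Type*} [ConvexEffectAlgebra E] [ConvexEffectAlgebra F] {φ : E → F}

theorem IsAffineIsomorphism.existsUnique_prod (hφ : IsAffineIsomorphism φ) (seq : E → E → E) :
    ∃! prod : F → F → F, ∀ a b : E, prod (φ a) (φ b) = φ (seq a b) := by
  obtain ⟨ψ, hψφ, hφψ⟩ := Function.bijective_iff_has_inverse.1 ⟨hφ.1.1.injective, hφ.1.2⟩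
  refine ⟨fun x y => φ (seq (ψ x) (ψ y)), fun a b => by simp only [hψφ _], fun prod h => ?_⟩
  funext x y
  rw [← h, hφψ, hφψ]

theorem IsSequentialProduct.transport {seq : E → E → E} (hseq : IsSequentialProduct seq)
    (hφ : IsAffineIsomorphism φ) {prod : F → F → F}
    (h : ∀ a b : E, prod (φ a) (φ b) = φ (seq a b)) : IsSequentialProduct prod := by
  obtain ⟨⟨hmono, hsurj⟩, hscale⟩ := hφ
  have hmor := hmono.1
  have hcomm (a b : E) : prod (φ a) (φ b) = prod (φ b) (φ a) ↔ seq a b = seq b a := by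
    rw [h, h, hmono.injective.eq_iff]
  constructor
  · refine hsurj.forall.2 fun a => isAdditive_iff.2 (hsurj.forall₃.2 fun b c d hbcd => ?_)
    have hbcd' : IsSum b c d := by
      have hbc := isSum_oplus (hmono.2 b c hbcd.1)
      rwa [hmono.injective ((hmor.map_isSum hbc).unique hbcd)] at hbc
    simp only [h]
    exact hmor.map_isSum (isAdditive_iff.1 (hseq.additive a) b c d hbcd')
  · refine hsurj.forall.2 fun a => ?_
    rw [← hmor.2, h, hseq.one_seq]
  · refine hsurj.forall₂.2 fun a b hab => (hcomm a b).2 (hseq.comm_of_eq_zero a b ?_)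
    rwa [h, ← hmor.map_zero, hmono.injective.eq_iff] at hab
  · refine hsurj.forall₂.2 fun a b hab => ?_
    rw [← hmor.map_compl]
    exact (hcomm _ _).2 (hseq.comm_compl a b ((hcomm a b).1 hab))
  · refine hsurj.forall₂.2 fun a b hab => hsurj.forall.2 fun c => ?_
    simp only [h]
    rw [hseq.assoc a b ((hcomm a b).1 hab)]
  · refine hsurj.forall₃.2 fun a b c hca hcb => ?_
    rw [h a b]
    exact (hcomm _ _).2 (hseq.comm_seq a b c ((hcomm c a).1 hca) ((hcomm c b).1 hcb))
  · refine hsurj.forall₃.2 fun a b c hca hcb hab => ?_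
    rw [← (hmor.map_isSum (isSum_oplus (hmono.2 a b hab))).unique (isSum_oplus hab)]
    exact (hcomm _ _).2 (hseq.comm_oplus a b c ((hcomm c a).1 hca) ((hcomm c b).1 hcb) _)
  · intro r
    refine hsurj.forall₂.2 fun a b => ?_
    rw [← hscale, h, h, hseq.scale_seq, hscale]
  · intro r
    refine hsurj.forall₂.2 fun a b => ?_
    rw [← hscale, h, h, hseq.seq_scale, hscale]

end Transport

theorem theorem4p6_general {E H : Type*} [ConvexEffectAlgebra E] [NormedAddCommGroup H]
    [InnerProductSpace ℂ H] [CompleteSpace H] [Nontrivial H]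
    (seq : E → E → E) (hseq : IsSequentialProduct seq)
    (hspectral : IsSpectral E)
    (hat : E → E → unitInterval) (hhat : IsStateChoice hat)
    (v : (A : Context E) → {a : E // a ∈ A.carrier} → H)
    (hv : IsCompleteVectorSystem hat v) :
    (∃! J : E → HilbertEffect H, IsVectorRepresentation v J) ∧
    ∀ J : E → HilbertEffect H, IsVectorRepresentation v J →
      IsAffineIsomorphism J ∧
      (∃! prod : HilbertEffect H → HilbertEffect H → HilbertEffect H,
        ∀ a b : E, prod (J a) (J b) = J (seq a b)) ∧
      ∀ prod : HilbertEffect H → HilbertEffect H → HilbertEffect H,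
        (∀ a b : E, prod (J a) (J b) = J (seq a b)) →
        IsSequentialProduct prod ∧ IsSEAIsomorphism seq prod J := by
  refine ⟨hv.existsUnique_isVectorRepresentation hhat hspectral, fun J hJ => ?_⟩
  have hiso := hJ.isAffineIsomorphism hspectral hv hhat
  exact ⟨hiso, hiso.existsUnique_prod seq, fun prod hprod =>
    ⟨hseq.transport hiso hprod, hiso, fun a b => (hprod a b).symm⟩⟩

end

theorem theorem4p6 {E : Type*} [ConvexEffectAlgebra E]
    (seq : E → E → E) (hseq : IsSequentialProduct seq)
    (hspectral : IsSpectral E)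
    (hat : E → E → unitInterval) (hhat : IsStateChoice hat)
    (U : (A B : Context E) → StateSpace A ≃ₗᵢ[ℂ] StateSpace B)
    (hU : IsCompleteComparison hat U)
    (B : Context E) :
    (∃! J : E → HilbertEffect (StateSpace B), IsHilbertRepresentation U B J) ∧
    ∀ J : E → HilbertEffect (StateSpace B), IsHilbertRepresentation U B J →
      IsAffineIsomorphism J ∧
      (∃! prod : HilbertEffect (StateSpace B) → HilbertEffect (StateSpace B) →
          HilbertEffect (StateSpace B), ∀ a b : E, prod (J a) (J b) = J (seq a b)) ∧
      ∀ prod : HilbertEffect (StateSpace B) → HilbertEffect (StateSpace B) →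
          HilbertEffect (StateSpace B), (∀ a b : E, prod (J a) (J b) = J (seq a b)) →
        IsSequentialProduct prod ∧ IsSEAIsomorphism seq prod J :=
  theorem4p6_general seq hseq hspectral hat hhat _ (hU.isCompleteVectorSystem B)
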